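/- All sets are finite and all Hilbert spaces are finite-dimensional complex; $L(\mathcal H)$ denotes the linear operators on $\mathcal H$, and a density matrix is a positive semidefinite operator of trace one. For a state $\rho_{AB}$ on $\mathcal H_A\otimes\mathcal H_B$, the conditional min-entropy is \[ H_{\min}(A|B)_\rho=\sup\{\lambda\in\mathbb R:\ \rho_{AB}\le 2^{-\lambda}\,\mathbb 1_A\otimes\omega_B\ \text{for some density matrix } \omega_B \text{ on } \mathcal H_B\}. \] A complete cq-channel on a Hilbert space $\mathcal H_R$ is a family $(\tau^y)_{y\in Y}$ of density matrices on $\mathcal H_R$ with $|Y|=(\dim\mathcal H_R)^2$ and $\operatorname{span}_{\mathbb C}\{\tau^y:y\in Y\}=L(\mathcal H_R)$. Let $(\rho_0,\rho_1)$ and $(\sigma_0,\sigma_1)$ be two pairs of density matrices on $\mathcal H_Q$ and $\mathcal H_{Q'}$, respectively. Given a set $U$, a complete cq-channel $(\tau^y)_{y\in Y}$ on $\mathcal H_R$ and a joint probability distribution $p$ on $U\times Y\times\{0,1\}$, put \[ \tilde\rho_{URQ}=\sum_{u,y,x}p(u,y,x)\,|u\rangle\langle u|\otimes\tau^y\otimes\rho_x,\qquad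 \tilde\sigma_{URQ'}=\sum_{u,y,x}p(u,y,x)\,|u\rangle\langle u|\otimes\tau^y\otimes\sigma_x . \] Write $(\rho_0,\rho_1)\succeq^*(\sigma_0,\sigma_1)$ if $H_{\min}(U|RQ)_{\tilde\rho}\le H_{\min}(U|RQ')_{\tilde\sigma}$ for every set $U$, every Hilbert space $\mathcal H_R$, every complete cq-channel on $\mathcal H_R$ and every $p$. Then $(\rho_0,\rho_1)\succeq^*(\sigma_0,\sigma_1)$ if and only if there is a completely positive trace-preserving linear map $\Phi:L(\mathcal H_Q)\to L(\mathcal H_{Q'})$ with $\Phi(\rho_i)=\sigma_i$ for $i=0,1$. Moreover, the comparison can be restricted: $(\rho_0,\rho_1)\succeq^*(\sigma_0,\sigma_1)$ holds if and only if the above inequality holds for all $U$ with $|U|=(\dim\mathcal H_{Q'})^2$, all $\mathcal H_R$ with $\mathcal H_R\cong\mathcal H_{Q'}$, all complete cq-channels on $\mathcal H_R$ and all $p$. -/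

import Mathlib

open scoped Kronecker MatrixOrder Matrix.Norms.L2Operator ComplexOrder CStarAlgebra

/-- `ρ` is a density matrix: positive semidefinite, with trace one. -/
def IsDensityMatrix {Q : Type*} [Fintype Q] (ρ : Matrix Q Q ℂ) : Prop :=
  ρ.PosSemidef ∧ ρ.trace = 1

/-- The conditional min-entropy `H_min(A|B)` of a state `ρ` of `A ⊗ B`: the supremum of the real
`l` such that `ρ ≤ 2 ^ (-l) • (1_A ⊗ ω_B)` for some density matrix `ω` of `B`. Here `≤` is the
Loewner order. -/
noncomputable def condMinEntropy {A B : Type*} [Fintype A] [DecidableEq A] [Fintype B]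
    (ρ : Matrix (A × B) (A × B) ℂ) : ℝ :=
  sSup {l : ℝ | ∃ ω : Matrix B B ℂ, IsDensityMatrix ω ∧
    ρ ≤ ((2 : ℝ) ^ (-l)) • ((1 : Matrix A A ℂ) ⊗ₖ ω)}

/-- A complete cq-channel on the Hilbert space `ℂ^R`: a family of `(dim)^2` density matrices which
spans the space of all operators. -/
def IsCompleteCQChannel {Y R : Type*} [Fintype Y] [Fintype R] (τ : Y → Matrix R R ℂ) : Prop :=
  Fintype.card Y = Fintype.card R ^ 2 ∧ (∀ y, IsDensityMatrix (τ y)) ∧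
    Submodule.span ℂ (Set.range τ) = ⊤

/-- The state `∑ u, ∑ y, ∑ x, p(u,y,x) |u⟩⟨u| ⊗ τ y ⊗ ρ x` of `U ⊗ (R ⊗ Q)`. -/
noncomputable def cqState {U Y R Q : Type*} [Fintype U] [DecidableEq U] [Fintype Y]
    (p : U × Y × Fin 2 → ℝ) (τ : Y → Matrix R R ℂ) (ρ : Fin 2 → Matrix Q Q ℂ) :
    Matrix (U × (R × Q)) (U × (R × Q)) ℂ :=
  ∑ u, ∑ y, ∑ x, p (u, y, x) • (Matrix.single u u (1 : ℂ) ⊗ₖ (τ y ⊗ₖ ρ x))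

/-- The comparison of the pairs `ρ` and `σ` for a fixed set `U` and a fixed cq-channel `τ` on `R`:
`H_min(U|RQ) ≤ H_min(U|RQ')` for every joint probability distribution on `U × Y × {0, 1}`. -/
def MoreInformativeWith (U : Type*) {Y R Q Q' : Type*} [Fintype U] [DecidableEq U] [Fintype Y]
    [Fintype R] [Fintype Q] [Fintype Q'] (τ : Y → Matrix R R ℂ)
    (ρ : Fin 2 → Matrix Q Q ℂ) (σ : Fin 2 → Matrix Q' Q' ℂ) : Prop :=
  ∀ p ∈ stdSimplex ℝ (U × Y × Fin 2),
    condMinEntropy (cqState p τ ρ) ≤ condMinEntropy (cqState p τ σ)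

/-- The complete information ordering `(ρ 0, ρ 1) ⪰* (σ 0, σ 1)`. All sets are finite and all
Hilbert spaces are finite-dimensional, so that index types in `Type` suffice. -/
def CompletelyMoreInformative {Q Q' : Type*} [Fintype Q] [Fintype Q']
    (ρ : Fin 2 → Matrix Q Q ℂ) (σ : Fin 2 → Matrix Q' Q' ℂ) : Prop :=
  ∀ (U Y R : Type) [Fintype U] [DecidableEq U] [Fintype Y] [Fintype R] (τ : Y → Matrix R R ℂ),
    IsCompleteCQChannel τ → MoreInformativeWith U τ ρ σ

/-- The complete information ordering, with the comparison restricted to auxiliary spaces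
of the same dimension as that of `Q'` and to sets `U` with `(dim Q')^2` elements. -/
def RestrictedCompletelyMoreInformative {Q Q' : Type*} [Fintype Q] [Fintype Q']
    (ρ : Fin 2 → Matrix Q Q ℂ) (σ : Fin 2 → Matrix Q' Q' ℂ) : Prop :=
  ∀ (U Y R : Type) [Fintype U] [DecidableEq U] [Fintype Y] [Fintype R] (τ : Y → Matrix R R ℂ),
    Fintype.card R = Fintype.card Q' → Fintype.card U = Fintype.card Q' ^ 2 →
    IsCompleteCQChannel τ → MoreInformativeWith U τ ρ σ

/-- The completely positive map `Φ` preserves the trace, i.e. it is a quantum channel (CPTP map). -/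
def IsTracePreserving {Q Q' : Type*} [Fintype Q] [DecidableEq Q] [Fintype Q'] [DecidableEq Q']
    (Φ : Matrix Q Q ℂ →CP Matrix Q' Q' ℂ) : Prop :=
  ∀ X : Matrix Q Q ℂ, (Φ X).trace = X.trace

/-!
A channel from `ρ` to `σ` can be applied to both sides of the inequalities
`cqBlock p τ ρ u ≤ 2 ^ (-l) • ω` which define the conditional min-entropy, so that it makes `ρ` more
informative than `σ` in the complete sense (`completelyMoreInformative_of_channel`).

For the converse, `2 ^ (-H_min)` is the best probability of guessing `u` by a measurement of
`R ⊗ Q`. Comparing these probabilities for all distributions `p` shows that the statistics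
`tr (B u * (τ y ⊗ σ x))` of any measurement `B` on `R ⊗ Q'` are also the statistics
`tr (M u * (τ y ⊗ ρ x))` of some measurement `M` on `R ⊗ Q`
(`MoreInformativeWith.exists_measurement`). Only one separation argument is needed: the achievable
statistics, taken together with the sum of the family of operators, form a closed convex cone
(`isClosed_image_statisticsMap`), and a functional which separates a point from this cone is both a
distribution `p` (after a shift and a scaling) and a dual feasible operator `X ≥ cqBlock p τ ρ u`.
The trace of `X` bounds the min-entropy of `ρ` from below, whereas weak duality, with `B` as a
guessing strategy, bounds that of `σ` from above.

Since the `τ y` span all operators, `M` acts on `X ⊗ ρ x` as `B` acts on `X ⊗ σ x`, for each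
operator `X` on `R`. For `R` of the dimension `d` of `Q'` and for the Bell measurement `B`, which
has `d ^ 2` outcomes, the teleportation protocol with `M` in place of `B` is therefore a channel
which takes `ρ x` to `σ x` (`exists_channel_of_measurement`). This uses the comparison only for
the sizes of `U` and `R` in the restricted ordering.
-/

/-! ### Completely positive maps between matrix algebras -/

theorem posSemidef_iff_exists_conjTranspose_mul_self {n : Type*} [Fintype n]
    {A : Matrix n n ℂ} : A.PosSemidef ↔ ∃ B : Matrix n n ℂ, A = B.conjTranspose * B := by
  classical
  rw [← Matrix.nonneg_iff_posSemidef, CStarAlgebra.nonneg_iff_eq_star_mul_self]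
  rfl

/-- An element of `CStarMatrix n n (Matrix Q Q ℂ)` is nonnegative in the spectral order iff the
matrix over `n × Q` with the same entries is positive semidefinite. -/
theorem cstarMatrix_nonneg_iff {n Q : Type*} [Fintype n] [Fintype Q] [DecidableEq Q]
    (M : CStarMatrix n n (Matrix Q Q ℂ)) :
    0 ≤ M ↔ (Matrix.of fun i j : n × Q => M i.1 j.1 i.2 j.2).PosSemidef := by
  constructor
  · rw [StarOrderedRing.nonneg_iff]
    intro h
    induction h using AddSubmonoid.closure_induction with
    | mem M hM =>
      obtain ⟨N, rfl⟩ := hM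
      rw [posSemidef_iff_exists_conjTranspose_mul_self]
      refine ⟨Matrix.of fun i j : n × Q => N i.1 j.1 i.2 j.2, ?_⟩
      ext i j
      simp [Matrix.mul_apply, CStarMatrix.mul_apply, Fintype.sum_prod_type, CStarMatrix.star_apply,
        Matrix.sum_apply]
    | zero => exact Matrix.PosSemidef.zero
    | add M N _ _ hM hN => exact hM.add hN
  · rw [posSemidef_iff_exists_conjTranspose_mul_self]
    rintro ⟨B, hB⟩
    let N : CStarMatrix n n (Matrix Q Q ℂ) :=
      CStarMatrix.ofMatrix (Matrix.of fun i j => Matrix.of fun a b => B (i, a) (j, b))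
    have h : M = star N * N := by
      ext i j a b
      have := congrFun (congrFun hB (i, a)) (j, b)
      simpa [N, Matrix.mul_apply, CStarMatrix.mul_apply, Fintype.sum_prod_type,
        CStarMatrix.star_apply, Matrix.sum_apply] using this
    rw [h]
    exact star_mul_self_nonneg N

/-- The ampliation `id_I ⊗ Φ` of a linear map `Φ` between matrix algebras. -/
def ampliation (I : Type*) {Q Q' : Type*} (Φ : Matrix Q Q ℂ →ₗ[ℂ] Matrix Q' Q' ℂ) :
    Matrix (I × Q) (I × Q) ℂ →ₗ[ℂ] Matrix (I × Q') (I × Q') ℂ where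
  toFun M := Matrix.of fun i j => Φ (Matrix.of fun a b => M (i.1, a) (j.1, b)) i.2 j.2
  map_add' M N := by
    ext i j
    exact congrFun (congrFun (map_add Φ (Matrix.of fun a b => M (i.1, a) (j.1, b))
      (Matrix.of fun a b => N (i.1, a) (j.1, b))) i.2) j.2
  map_smul' c M := by
    ext i j
    exact congrFun (congrFun (map_smul Φ c (Matrix.of fun a b => M (i.1, a) (j.1, b))) i.2) j.2

theorem ampliation_kronecker {I Q Q' : Type*} (Φ : Matrix Q Q ℂ →ₗ[ℂ] Matrix Q' Q' ℂ)
    (A : Matrix I I ℂ) (B : Matrix Q Q ℂ) : ampliation I Φ (A ⊗ₖ B) = A ⊗ₖ Φ B := by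
  ext i j
  exact congrFun (congrFun (map_smul Φ (A i.1 j.1) B) i.2) j.2

theorem trace_ampliation {I Q Q' : Type*} [Fintype I] [Fintype Q] [Fintype Q']
    (Φ : Matrix Q Q ℂ →ₗ[ℂ] Matrix Q' Q' ℂ) (hΦ : ∀ X, (Φ X).trace = X.trace)
    (M : Matrix (I × Q) (I × Q) ℂ) : (ampliation I Φ M).trace = M.trace := by
  have h (i : I) := hΦ (Matrix.of fun a b => M (i, a) (i, b))
  simp only [Matrix.trace, Matrix.diag] at h
  simp only [Matrix.trace, Matrix.diag, Fintype.sum_prod_type]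
  exact Finset.sum_congr rfl fun i _ => h i

theorem posSemidef_ampliation {I Q Q' : Type*} [Fintype I] [Fintype Q] [DecidableEq Q]
    [Fintype Q'] [DecidableEq Q'] (Φ : Matrix Q Q ℂ →CP Matrix Q' Q' ℂ)
    {M : Matrix (I × Q) (I × Q) ℂ} (hM : M.PosSemidef) :
    (ampliation I Φ.toLinearMap M).PosSemidef := by
  have h := Φ.map_cstarMatrix_nonneg
    (CStarMatrix.ofMatrix (Matrix.of fun i j : I => Matrix.of fun a b => M (i, a) (j, b)))
    ((cstarMatrix_nonneg_iff _).2 hM)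
  exact (cstarMatrix_nonneg_iff _).1 h

/-- The completely positive map `X ↦ ∑ s, K s * X * (K s)ᴴ` with Kraus operators `K`. -/
noncomputable def krausMap {S Q Q' : Type*} [Fintype S] [Fintype Q] [DecidableEq Q]
    [Fintype Q'] [DecidableEq Q'] (K : S → Matrix Q' Q ℂ) : Matrix Q Q ℂ →CP Matrix Q' Q' ℂ where
  toFun X := ∑ s, K s * X * (K s).conjTranspose
  map_add' X Y := by simp [Matrix.mul_add, Matrix.add_mul, Finset.sum_add_distrib]
  map_smul' c X := by simp [Finset.smul_sum]
  map_cstarMatrix_nonneg' k M hM := by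
    rw [cstarMatrix_nonneg_iff] at hM ⊢
    -- The flattened image is `∑ s, (1 ⊗ K s) * M * (1 ⊗ K s)ᴴ`.
    have h := Matrix.posSemidef_sum Finset.univ fun s _ =>
      hM.mul_mul_conjTranspose_same ((1 : Matrix (Fin k) (Fin k) ℂ) ⊗ₖ K s)
    convert! h using 1
    ext ⟨i, a⟩ ⟨j, b⟩
    simp [Matrix.sum_apply, Matrix.mul_apply, Fintype.sum_prod_type, Matrix.one_apply,
      Finset.sum_mul, apply_ite (starRingEnd ℂ)]

theorem krausMap_apply {S Q Q' : Type*} [Fintype S] [Fintype Q] [DecidableEq Q]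
    [Fintype Q'] [DecidableEq Q'] (K : S → Matrix Q' Q ℂ) (X : Matrix Q Q ℂ) :
    krausMap K X = ∑ s, K s * X * (K s).conjTranspose := rfl

/-! ### Blocks of classical-quantum states -/

/-- The subnormalized state of `R ⊗ Q` which `cqState p τ ρ` carries for the value `u` of the
classical register. -/
noncomputable def cqBlock {U Y R Q : Type*} [Fintype Y]
    (p : U × Y × Fin 2 → ℝ) (τ : Y → Matrix R R ℂ) (ρ : Fin 2 → Matrix Q Q ℂ) (u : U) :
    Matrix (R × Q) (R × Q) ℂ :=
  ∑ y, ∑ x, p (u, y, x) • (τ y ⊗ₖ ρ x)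

theorem cqState_apply {U Y R Q : Type*} [Fintype U] [DecidableEq U] [Fintype Y]
    (p : U × Y × Fin 2 → ℝ) (τ : Y → Matrix R R ℂ) (ρ : Fin 2 → Matrix Q Q ℂ)
    (u v : U) (i j : R × Q) :
    cqState p τ ρ (u, i) (v, j) = if u = v then cqBlock p τ ρ u i j else 0 := by
  simp only [cqState, cqBlock, Matrix.sum_apply, Matrix.smul_apply, Matrix.kroneckerMap_apply,
    Matrix.single_apply]
  split_ifs with h
  · subst h
    rw [Finset.sum_eq_single u] <;> simp +contextual
  · refine Finset.sum_eq_zero fun w _ => ?_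
    have : ¬ (w = u ∧ w = v) := fun hw => h (hw.1.symm.trans hw.2)
    simp [this]

/-- A classical-quantum state is bounded by `1 ⊗ c ω` iff each of its blocks is bounded by `c ω`. -/
theorem cqState_le_iff {U Y R Q : Type*} [Fintype U] [DecidableEq U] [Fintype Y] [Fintype R]
    [Fintype Q] (p : U × Y × Fin 2 → ℝ) (τ : Y → Matrix R R ℂ) (ρ : Fin 2 → Matrix Q Q ℂ)
    (c : ℝ) (ω : Matrix (R × Q) (R × Q) ℂ) :
    cqState p τ ρ ≤ c • ((1 : Matrix U U ℂ) ⊗ₖ ω) ↔ ∀ u, cqBlock p τ ρ u ≤ c • ω := by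
  simp only [Matrix.le_iff]
  constructor
  · intro h u
    convert! h.submatrix (fun i : R × Q => (u, i)) using 1
    ext i j
    simp [cqState_apply]
  · intro h
    have h1 := Matrix.posSemidef_sum Finset.univ fun u _ =>
      (Matrix.posSemidef_vecMulVec_self_star (Pi.single u 1 : U → ℂ)).kronecker (h u)
    convert! h1 using 1
    ext ⟨u, i⟩ ⟨v, j⟩
    simp only [Matrix.sub_apply, Matrix.smul_apply, Matrix.kroneckerMap_apply, cqState_apply,
      Matrix.sum_apply, Matrix.vecMulVec_apply, Matrix.one_apply]
    split_ifs with huv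
    · subst huv
      rw [Finset.sum_eq_single u]
      · simp
      · intro b _ hb
        simp [hb.symm]
      · simp
    · rw [Finset.sum_eq_zero]
      · simp
      · intro b _
        by_cases hb : u = b
        · subst hb; simp [Ne.symm huv]
        · simp [Pi.single_apply, hb]

theorem ampliation_cqBlock {U Y R Q Q' : Type*} [Fintype Y]
    (Φ : Matrix Q Q ℂ →ₗ[ℂ] Matrix Q' Q' ℂ)
    (p : U × Y × Fin 2 → ℝ) (τ : Y → Matrix R R ℂ) (ρ : Fin 2 → Matrix Q Q ℂ) (u : U) :
    ampliation R Φ (cqBlock p τ ρ u) = cqBlock p τ (fun x => Φ (ρ x)) u := by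
  simp only [cqBlock, map_sum, LinearMap.map_smul_of_tower, ampliation_kronecker]

/-! ### Bounds on the conditional min-entropy -/

theorem trace_mul_nonneg_of_posSemidef {n : Type*} [Fintype n] {A B : Matrix n n ℂ}
    (hA : A.PosSemidef) (hB : B.PosSemidef) : 0 ≤ (A * B).trace := by
  obtain ⟨C, rfl⟩ := posSemidef_iff_exists_conjTranspose_mul_self.1 hA
  rw [Matrix.mul_assoc, Matrix.trace_mul_comm]
  exact (hB.mul_mul_conjTranspose_same C).trace_nonneg

theorem IsDensityMatrix.kronecker {R Q : Type*} [Fintype R] [Fintype Q] {A : Matrix R R ℂ}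
    {B : Matrix Q Q ℂ} (hA : IsDensityMatrix A) (hB : IsDensityMatrix B) :
    IsDensityMatrix (A ⊗ₖ B) :=
  ⟨hA.1.kronecker hB.1, by rw [Matrix.trace_kronecker, hA.2, hB.2, one_mul]⟩

theorem IsDensityMatrix.nonempty {Q : Type*} [Fintype Q] {A : Matrix Q Q ℂ}
    (hA : IsDensityMatrix A) : Nonempty Q := by
  by_contra h
  rw [not_nonempty_iff] at h
  simpa [Matrix.trace] using hA.2

/-- A positive semidefinite matrix of positive trace is a multiple of a density matrix. -/
theorem exists_isDensityMatrix_smul {Q : Type*} [Fintype Q] {X : Matrix Q Q ℂ} (hX : X.PosSemidef)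
    (ht : 0 < X.trace.re) : ∃ ω : Matrix Q Q ℂ, IsDensityMatrix ω ∧ X = X.trace.re • ω := by
  refine ⟨X.trace.re⁻¹ • X, ⟨hX.smul (inv_nonneg.2 ht.le), ?_⟩, ?_⟩
  · have h : X.trace = X.trace.re := by
      apply Complex.ext
      · simp
      · simpa using (Complex.nonneg_iff.1 hX.trace_nonneg).2.symm
    rw [Matrix.trace_smul, Complex.real_smul]
    nth_rewrite 2 [h]
    rw [← Complex.ofReal_mul, inv_mul_cancel₀ ht.ne', Complex.ofReal_one]
  · rw [smul_smul, mul_inv_cancel₀ ht.ne', one_smul]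

section

variable {U Y R Q : Type*} [Fintype U] [DecidableEq U] [Fintype Y] [Fintype R] [Fintype Q]
  {p : U × Y × Fin 2 → ℝ} {τ : Y → Matrix R R ℂ} {ρ : Fin 2 → Matrix Q Q ℂ}

omit [DecidableEq U] [Fintype U] in
theorem posSemidef_cqBlock (hp : ∀ i, 0 ≤ p i) (hτ : ∀ y, IsDensityMatrix (τ y))
    (hρ : ∀ x, IsDensityMatrix (ρ x)) (u : U) : (cqBlock p τ ρ u).PosSemidef :=
  Matrix.posSemidef_sum _ fun y _ => Matrix.posSemidef_sum _ fun x _ =>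
    ((hτ y).kronecker (hρ x)).1.smul (hp _)

omit [DecidableEq U] in
theorem sum_trace_cqBlock (hp : p ∈ stdSimplex ℝ (U × Y × Fin 2))
    (hτ : ∀ y, IsDensityMatrix (τ y)) (hρ : ∀ x, IsDensityMatrix (ρ x)) :
    ∑ u, (cqBlock p τ ρ u).trace = 1 := by
  simp only [cqBlock, Matrix.trace_sum, Matrix.trace_smul, ((hτ _).kronecker (hρ _)).2]
  have h := hp.2
  simp only [Fintype.sum_prod_type] at h
  simp only [Complex.real_smul, mul_one]
  exact_mod_cast h

theorem condMinEntropy_cqState : condMinEntropy (cqState p τ ρ) =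
    sSup {l : ℝ | ∃ ω : Matrix (R × Q) (R × Q) ℂ, IsDensityMatrix ω ∧
      ∀ u, cqBlock p τ ρ u ≤ ((2 : ℝ) ^ (-l)) • ω} := by
  simp only [condMinEntropy, cqState_le_iff]

omit [DecidableEq U] in
/-- Weak duality: no measurement guesses `u` with a probability above `2 ^ (-l)`, if the blocks are
bounded by `2 ^ (-l) • ω`. -/
theorem sum_trace_mul_cqBlock_le [DecidableEq R] [DecidableEq Q] {l : ℝ}
    {ω : Matrix (R × Q) (R × Q) ℂ} (hω : IsDensityMatrix ω)
    (h : ∀ u, cqBlock p τ ρ u ≤ ((2 : ℝ) ^ (-l)) • ω)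
    {M : U → Matrix (R × Q) (R × Q) ℂ} (hM : ∀ u, (M u).PosSemidef) (hM1 : ∑ u, M u = 1) :
    (∑ u, (M u * cqBlock p τ ρ u).trace).re ≤ (2 : ℝ) ^ (-l) := by
  have h1 : 0 ≤ ∑ u, (M u * (((2 : ℝ) ^ (-l)) • ω - cqBlock p τ ρ u)).trace :=
    Finset.sum_nonneg fun u _ => trace_mul_nonneg_of_posSemidef (hM u) (h u)
  simp only [Matrix.mul_sub, Matrix.trace_sub, Finset.sum_sub_distrib] at h1
  rw [← Matrix.trace_sum, ← Finset.sum_mul, hM1, Matrix.one_mul, Matrix.trace_smul, hω.2] at h1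
  have h2 := (Complex.nonneg_iff.1 h1).1
  simpa [-Complex.re_sum] using h2

omit [DecidableEq U] in
theorem bddAbove_condMinEntropy_set (hp : p ∈ stdSimplex ℝ (U × Y × Fin 2))
    (hτ : ∀ y, IsDensityMatrix (τ y)) (hρ : ∀ x, IsDensityMatrix (ρ x)) :
    BddAbove {l : ℝ | ∃ ω : Matrix (R × Q) (R × Q) ℂ, IsDensityMatrix ω ∧
      ∀ u, cqBlock p τ ρ u ≤ ((2 : ℝ) ^ (-l)) • ω} := by
  refine ⟨Real.logb 2 (Fintype.card U), ?_⟩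
  rintro l ⟨ω, hω, h⟩
  have h1 : 0 ≤ ∑ u, (((2 : ℝ) ^ (-l)) • ω - cqBlock p τ ρ u).trace :=
    Finset.sum_nonneg fun u _ => (h u : Matrix.PosSemidef _).trace_nonneg
  simp only [Matrix.trace_sub, Finset.sum_sub_distrib, sum_trace_cqBlock hp hτ hρ,
    Matrix.trace_smul, hω.2] at h1
  have h2 := (Complex.nonneg_iff.1 h1).1
  simp only [Finset.sum_const, Finset.card_univ, Complex.real_smul, mul_one, nsmul_eq_mul,
    Complex.sub_re, Complex.one_re, ← Complex.ofReal_natCast, ← Complex.ofReal_mul,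
    Complex.ofReal_re, Real.rpow_neg (by norm_num : (0 : ℝ) ≤ 2)] at h2
  have hl : (0 : ℝ) < 2 ^ l := Real.rpow_pos_of_pos two_pos l
  have h3 : (2 : ℝ) ^ l ≤ Fintype.card U := by
    rw [← div_eq_mul_inv, sub_nonneg, one_le_div hl] at h2
    exact h2
  exact (Real.le_logb_iff_rpow_le one_lt_two (hl.trans_le h3)).2 h3

theorem neg_logb_trace_le_condMinEntropy (hp : p ∈ stdSimplex ℝ (U × Y × Fin 2))
    (hτ : ∀ y, IsDensityMatrix (τ y)) (hρ : ∀ x, IsDensityMatrix (ρ x))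
    {X : Matrix (R × Q) (R × Q) ℂ} (hX : X.PosSemidef) (ht : 0 < X.trace.re)
    (h : ∀ u, cqBlock p τ ρ u ≤ X) :
    -Real.logb 2 X.trace.re ≤ condMinEntropy (cqState p τ ρ) := by
  rw [condMinEntropy_cqState]
  obtain ⟨ω, hω, hXω⟩ := exists_isDensityMatrix_smul hX ht
  refine le_csSup (bddAbove_condMinEntropy_set hp hτ hρ) ⟨ω, hω, fun u => ?_⟩
  rw [neg_neg, Real.rpow_logb two_pos (by norm_num) ht, ← hXω]
  exact h u

omit [DecidableEq U] in
/-- The exponent `0` is always admissible: each block is bounded by the marginal state of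
`R ⊗ Q`. -/
theorem nonempty_condMinEntropy_set (hp : p ∈ stdSimplex ℝ (U × Y × Fin 2))
    (hτ : ∀ y, IsDensityMatrix (τ y)) (hρ : ∀ x, IsDensityMatrix (ρ x)) :
    {l : ℝ | ∃ ω : Matrix (R × Q) (R × Q) ℂ, IsDensityMatrix ω ∧
      ∀ u, cqBlock p τ ρ u ≤ ((2 : ℝ) ^ (-l)) • ω}.Nonempty := by
  refine ⟨0, ∑ u, cqBlock p τ ρ u,
    ⟨Matrix.posSemidef_sum _ fun u _ => posSemidef_cqBlock hp.1 hτ hρ u, ?_⟩, fun u => ?_⟩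
  · rw [Matrix.trace_sum, sum_trace_cqBlock hp hτ hρ]
  · rw [neg_zero, Real.rpow_zero, one_smul]
    exact Finset.single_le_sum
      (fun v _ => Matrix.nonneg_iff_posSemidef.2 (posSemidef_cqBlock hp.1 hτ hρ v))
      (Finset.mem_univ u)

theorem condMinEntropy_le_neg_logb [DecidableEq R] [DecidableEq Q]
    (hp : p ∈ stdSimplex ℝ (U × Y × Fin 2))
    (hτ : ∀ y, IsDensityMatrix (τ y)) (hρ : ∀ x, IsDensityMatrix (ρ x))
    {M : U → Matrix (R × Q) (R × Q) ℂ} (hM : ∀ u, (M u).PosSemidef) (hM1 : ∑ u, M u = 1)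
    (hpos : 0 < (∑ u, (M u * cqBlock p τ ρ u).trace).re) :
    condMinEntropy (cqState p τ ρ) ≤
      -Real.logb 2 (∑ u, (M u * cqBlock p τ ρ u).trace).re := by
  rw [condMinEntropy_cqState]
  refine csSup_le (nonempty_condMinEntropy_set hp hτ hρ) ?_
  rintro l ⟨ω, hω, h⟩
  have h1 := sum_trace_mul_cqBlock_le hω h hM hM1
  rw [le_neg, Real.logb_le_iff_le_rpow one_lt_two hpos]
  exact h1

end

/-! ### Data processing -/

/-- Data processing: a channel which maps `ρ` to `σ` makes `ρ` more informative than `σ`, since it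
can be applied to both sides of the inequalities that define the conditional min-entropy. -/
theorem completelyMoreInformative_of_channel {Q Q' : Type*} [Fintype Q] [DecidableEq Q]
    [Fintype Q'] [DecidableEq Q'] {ρ : Fin 2 → Matrix Q Q ℂ} {σ : Fin 2 → Matrix Q' Q' ℂ}
    (hρ : ∀ i, IsDensityMatrix (ρ i)) (hσ : ∀ i, IsDensityMatrix (σ i))
    (Φ : Matrix Q Q ℂ →CP Matrix Q' Q' ℂ) (hΦ : IsTracePreserving Φ) (h : ∀ i, Φ (ρ i) = σ i) :
    CompletelyMoreInformative ρ σ := by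
  intro U Y R _ _ _ _ τ hτ p hp
  rw [condMinEntropy_cqState, condMinEntropy_cqState]
  refine csSup_le_csSup (bddAbove_condMinEntropy_set hp hτ.2.1 hσ)
    (nonempty_condMinEntropy_set hp hτ.2.1 hρ) ?_
  rintro l ⟨ω, hω, hl⟩
  refine ⟨ampliation R Φ.toLinearMap ω, ⟨posSemidef_ampliation Φ hω.1, ?_⟩, fun u => ?_⟩
  · rw [trace_ampliation _ hΦ, hω.2]
  · have h1 := posSemidef_ampliation Φ (hl u : Matrix.PosSemidef _)
    rw [map_sub, LinearMap.map_smul_of_tower, ampliation_cqBlock] at h1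
    obtain rfl : (fun i => Φ (ρ i)) = σ := funext h
    exact h1

/-! ### Duality for the statistics of measurements -/

theorem Matrix.IsHermitian.posSemidef_of_trace_mul_nonneg {n : Type*} [Fintype n]
    {B : Matrix n n ℂ} (hB : B.IsHermitian)
    (h : ∀ P : Matrix n n ℂ, P.PosSemidef → 0 ≤ (B * P).trace.re) : B.PosSemidef := by
  refine Matrix.PosSemidef.of_dotProduct_mulVec_nonneg hB fun v => ?_
  have h1 := h _ (Matrix.posSemidef_vecMulVec_self_star v)
  rw [Matrix.mul_vecMulVec, Matrix.trace_vecMulVec, dotProduct_comm] at h1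
  exact Complex.nonneg_iff.2 ⟨h1, (hB.im_star_dotProduct_mulVec_self v).symm⟩

/-- Each linear functional on matrices is of the form `S ↦ tr (Z * S)`. -/
theorem exists_eq_trace_mul {n : Type*} [Fintype n] [DecidableEq n]
    (g : Matrix n n ℂ →ₗ[ℂ] ℂ) : ∃ Z : Matrix n n ℂ, ∀ S, g S = (Z * S).trace := by
  refine ⟨Matrix.of fun i j => g (Matrix.single j i 1), fun S => ?_⟩
  conv_lhs => rw [Matrix.matrix_eq_sum_single S]
  simp only [map_sum, Matrix.trace, Matrix.diag, Matrix.mul_apply, Matrix.of_apply]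
  rw [Finset.sum_comm]
  refine Finset.sum_congr rfl fun i _ => Finset.sum_congr rfl fun j _ => ?_
  rw [← mul_one (S j i), ← smul_eq_mul (S j i), ← Matrix.smul_single, map_smul, smul_eq_mul,
    smul_eq_mul, mul_one, mul_comm]

section

variable {U κ n : Type*} [Fintype U] [Fintype n] [DecidableEq n]

/-- The map which sends a family `M` of operators to its statistics `tr (M u * A k)` on the
operators `A k`, together with the sum of the family. -/
noncomputable def statisticsMap (A : κ → Matrix n n ℂ) :
    (U → Matrix n n ℂ) →ₗ[ℂ] (U → κ → ℂ) × Matrix n n ℂ where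
  toFun M := (fun u k => (M u * A k).trace, ∑ u, M u)
  map_add' M N := by
    ext <;> simp [Matrix.add_mul, Finset.sum_add_distrib]
  map_smul' c M := by
    ext <;> simp [Finset.mul_sum, Matrix.sum_apply]

/-- The cone of the statistics of all positive families is closed: a bound on the sum of a positive
family bounds its members, so that near each point the cone is the image of a compact set. -/
theorem isClosed_image_statisticsMap (A : κ → Matrix n n ℂ) :
    IsClosed (statisticsMap A '' {M : U → Matrix n n ℂ | ∀ u, 0 ≤ M u}) := by
  have : ProperSpace (U → Matrix n n ℂ) := FiniteDimensional.proper ℂ _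
  have hL : Continuous (statisticsMap (U := U) A) := LinearMap.continuous_of_finiteDimensional _
  have hC : IsClosed {M : U → Matrix n n ℂ | ∀ u, 0 ≤ M u} := by
    simp only [Set.ofPred_forall]
    exact isClosed_iInter fun u => isClosed_le continuous_const (continuous_apply u)
  refine isClosed_of_closure_subset fun x hx => ?_
  set r := ‖x.2‖ + 1 with hr
  have hN : IsOpen {y : (U → κ → ℂ) × Matrix n n ℂ | ‖y.2‖ < r} :=
    isOpen_lt (by fun_prop) continuous_const
  have h1 := hN.inter_closure ⟨by simp [hr], hx⟩
  have h2 : IsCompact (statisticsMap A ''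
      ({M : U → Matrix n n ℂ | ∀ u, 0 ≤ M u} ∩ Metric.closedBall 0 r)) :=
    ((isCompact_closedBall _ _).inter_left hC).image hL
  refine Set.image_mono Set.inter_subset_left (closure_minimal ?_ h2.isClosed h1)
  rintro _ ⟨hy, M, hM, rfl⟩
  refine ⟨M, ⟨hM, ?_⟩, rfl⟩
  rw [mem_closedBall_zero_iff, pi_norm_le_iff_of_nonneg (by positivity)]
  intro u
  refine le_trans ?_ (le_of_lt hy)
  exact CStarAlgebra.norm_le_norm_of_nonneg_of_le (hM u)
    (Finset.single_le_sum (fun v _ => hM v) (Finset.mem_univ u))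

/-- A Farkas lemma for measurements: the statistics `b` are those of a measurement on the positive
operators `A k` if, in each guessing game with payoffs `c`, the payoff of `b` is at most the value
`tr X` of each dual feasible point `X`. Otherwise a functional `(c, -X)` separates `(b, 1)` from the
cone of achievable statistics, and gives a game and a dual feasible point which violate this. -/
theorem exists_measurement_of_forall_dual [Fintype κ] (A : κ → Matrix n n ℂ) (hA : ∀ k, (A k).PosSemidef)
    (b : U → κ → ℝ)
    (h : ∀ (c : U → κ → ℝ) (X : Matrix n n ℂ), (∀ u, ∑ k, c u k • A k ≤ X) →
      ∑ u, ∑ k, c u k * b u k ≤ X.trace.re) :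
    ∃ M : U → Matrix n n ℂ, (∀ u, (M u).PosSemidef) ∧ ∑ u, M u = 1 ∧
      ∀ u k, (M u * A k).trace = b u k := by
  classical
  by_contra hcon
  set C := {M : U → Matrix n n ℂ | ∀ u, 0 ≤ M u} with hC
  have hconv : Convex ℝ (statisticsMap A '' C) := by
    have h1 : Convex ℝ C := by
      intro M hM N hN s t hs ht _ u
      exact add_nonneg (smul_nonneg hs (hM u)) (smul_nonneg ht (hN u))
    exact h1.linear_image ((statisticsMap A).restrictScalars ℝ)
  have hx : ((fun u k => (b u k : ℂ), 1) : (U → κ → ℂ) × Matrix n n ℂ) ∉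
      statisticsMap A '' C := by
    rintro ⟨M, hM, hMb⟩
    have h1 := congrArg Prod.fst hMb
    exact hcon ⟨M, fun u => Matrix.nonneg_iff_posSemidef.1 (hM u), congrArg Prod.snd hMb,
      fun u k => congrFun (congrFun h1 u) k⟩
  obtain ⟨f, v, hf, hv⟩ := RCLike.geometric_hahn_banach_closed_point (𝕜 := ℂ) hconv
    (isClosed_image_statisticsMap A) hx
  simp only [RCLike.re_eq_complex_re] at hf hv
  have hv0 : 0 < v := by simpa using hf 0 ⟨0, fun u => le_rfl, map_zero _⟩
  -- A functional which is bounded above on a cone is nonpositive there.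
  have hf0 : ∀ M ∈ C, (f (statisticsMap A M)).re ≤ 0 := by
    intro M hM
    by_contra! hpos
    have h1 := hf (statisticsMap A (((v / (f (statisticsMap A M)).re : ℝ) : ℂ) • M))
      ⟨_, fun u => ?_, rfl⟩
    · rw [map_smul, map_smul, smul_eq_mul, Complex.re_ofReal_mul, div_mul_cancel₀ _ hpos.ne'] at h1
      exact lt_irrefl _ h1
    · exact smul_nonneg (Complex.zero_le_real.2 (by positivity)) (hM u)
  obtain ⟨Z, hZ⟩ := exists_eq_trace_mul
    (f.toLinearMap ∘ₗ LinearMap.inr ℂ (U → κ → ℂ) (Matrix n n ℂ))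
  set c : U → κ → ℝ := fun u k => (f (Pi.single u (Pi.single k 1), 0)).re with hc
  have hfc (t : U → κ → ℝ) (S : Matrix n n ℂ) : (f (fun u k => (t u k : ℂ), S)).re =
      ∑ u, ∑ k, c u k * t u k + (Z * S).trace.re := by
    rw [← hZ S]
    have h1 : ((fun u k => (t u k : ℂ), S) : (U → κ → ℂ) × Matrix n n ℂ) =
        ∑ u, ∑ k, (t u k : ℂ) • (Pi.single u (Pi.single k 1), 0) + (0, S) := by
      refine Prod.ext ?_ ?_
      · ext u k
        simp [Prod.fst_sum, Finset.sum_apply, Pi.single_apply, apply_ite]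
      · simp [Prod.snd_sum]
    rw [h1, map_add, map_sum, Complex.add_re, Complex.re_sum]
    congr 1
    refine Finset.sum_congr rfl fun u _ => ?_
    rw [map_sum, Complex.re_sum]
    refine Finset.sum_congr rfl fun k _ => ?_
    rw [map_smul, smul_eq_mul, Complex.re_ofReal_mul, mul_comm]
  -- The dual feasible point is minus the Hermitian part of `Z`.
  set X : Matrix n n ℂ := -((1 / 2 : ℝ) • (Z + Z.conjTranspose)) with hX
  have hXh : X.IsHermitian := by
    rw [hX, Matrix.IsHermitian, Matrix.conjTranspose_neg, Matrix.conjTranspose_smul,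
      Matrix.conjTranspose_add, Matrix.conjTranspose_conjTranspose, add_comm, star_trivial]
  have hXZ (P : Matrix n n ℂ) (hP : P.IsHermitian) : (X * P).trace.re = -(Z * P).trace.re := by
    have h1 : (Z.conjTranspose * P).trace.re = (Z * P).trace.re := by
      have h2 : Z.conjTranspose * P = (P * Z).conjTranspose := by
        rw [Matrix.conjTranspose_mul, hP]
      rw [h2, Matrix.trace_conjTranspose, Matrix.trace_mul_comm]
      simp
    rw [hX, Matrix.neg_mul, Matrix.smul_mul, Matrix.add_mul, Matrix.trace_neg, Matrix.trace_smul,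
      Matrix.trace_add, Complex.neg_re, Complex.real_smul, Complex.re_ofReal_mul, Complex.add_re, h1]
    ring
  have hle (u : U) : ∑ k, c u k • A k ≤ X := by
    rw [Matrix.le_iff]
    refine Matrix.IsHermitian.posSemidef_of_trace_mul_nonneg (hXh.sub ?_) fun P hP => ?_
    · exact isSelfAdjoint_sum _ fun k _ => (IsSelfAdjoint.all (c u k)).smul (hA k).1
    · have h1 := hf0 (Pi.single u P) fun w => by
        by_cases hw : w = u
        · subst hw; simpa using Matrix.nonneg_iff_posSemidef.2 hP
        · simp [hw]
      have h2 : statisticsMap A (Pi.single u P) = (fun w k =>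
          (((if w = u then (P * A k).trace.re else 0 : ℝ)) : ℂ), P) := by
        refine Prod.ext ?_ ?_
        · ext w k
          by_cases hw : w = u
          · subst hw
            simpa [statisticsMap] using (Complex.eq_re_of_ofReal_le (r := 0)
              (by simpa using trace_mul_nonneg_of_posSemidef hP (hA k)))
          · simp [statisticsMap, hw]
        · simp [statisticsMap]
      rw [h2, hfc] at h1
      rw [Finset.sum_eq_single u (fun w _ hw => by simp [hw]) (by simp)] at h1
      simp only [if_true] at h1
      rw [Matrix.sub_mul, Matrix.trace_sub, Complex.sub_re, hXZ P hP.1, Finset.sum_mul,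
        Matrix.trace_sum, Complex.re_sum]
      have h3 : ∑ k, (c u k • A k * P).trace.re = ∑ k, c u k * (P * A k).trace.re := by
        refine Finset.sum_congr rfl fun k _ => ?_
        rw [Matrix.smul_mul, Matrix.trace_smul, Complex.real_smul, Complex.re_ofReal_mul,
          Matrix.trace_mul_comm]
      linarith
  have h1 := h c X hle
  have h2 := hXZ 1 Matrix.isHermitian_one
  rw [Matrix.mul_one, Matrix.mul_one] at h2
  rw [hfc, Matrix.mul_one] at hv
  linarith

end

/-! ### From the entropy comparison to measurements -/

/-- The block `u` for an affine transform of the weights `c`. The shift `s` contributes a term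
which does not depend on `u`. -/
theorem cqBlock_affine {U Y R Q : Type*} [Fintype Y] (τ : Y → Matrix R R ℂ)
    (ρ : Fin 2 → Matrix Q Q ℂ) (c : U → Y × Fin 2 → ℝ) (r s : ℝ) (u : U) :
    cqBlock (fun i => r * (c i.1 i.2 + s)) τ ρ u =
      r • (∑ k : Y × Fin 2, c u k • (τ k.1 ⊗ₖ ρ k.2) +
        s • ∑ k : Y × Fin 2, (τ k.1 ⊗ₖ ρ k.2)) := by
  simp only [cqBlock, Finset.smul_sum, ← Finset.sum_add_distrib, Fintype.sum_prod_type, smul_smul,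
    ← add_smul]

section

variable {U Y R Q Q' : Type*} [Fintype U] [DecidableEq U] [Fintype Y] [Fintype R]
  [DecidableEq R] [Fintype Q] [Fintype Q'] [DecidableEq Q']
  {τ : Y → Matrix R R ℂ} {ρ : Fin 2 → Matrix Q Q ℂ} {σ : Fin 2 → Matrix Q' Q' ℂ}

/-- If `ρ` is more informative than `σ`, then a dual feasible point `X` for `ρ` bounds the guessing
probability of each measurement on `σ`. -/
theorem MoreInformativeWith.sum_trace_mul_cqBlock_le (h : MoreInformativeWith U τ ρ σ)
    (hτ : ∀ y, IsDensityMatrix (τ y)) (hρ : ∀ i, IsDensityMatrix (ρ i))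
    (hσ : ∀ i, IsDensityMatrix (σ i)) {B : U → Matrix (R × Q') (R × Q') ℂ}
    (hB : ∀ u, (B u).PosSemidef) (hB1 : ∑ u, B u = 1)
    {p : U × Y × Fin 2 → ℝ} (hp : p ∈ stdSimplex ℝ (U × Y × Fin 2))
    {X : Matrix (R × Q) (R × Q) ℂ} (hX : ∀ u, cqBlock p τ ρ u ≤ X) :
    (∑ u, (B u * cqBlock p τ σ u).trace).re ≤ X.trace.re := by
  have htr (u : U) : 0 ≤ (cqBlock p τ ρ u).trace.re ∧
      (cqBlock p τ ρ u).trace.re ≤ X.trace.re := by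
    refine ⟨(Complex.nonneg_iff.1 (posSemidef_cqBlock hp.1 hτ hρ u).trace_nonneg).1, ?_⟩
    have h1 := (Complex.nonneg_iff.1 (hX u : Matrix.PosSemidef _).trace_nonneg).1
    rwa [Matrix.trace_sub, Complex.sub_re, sub_nonneg] at h1
  -- The blocks have total trace one, so that one of them has positive trace.
  obtain ⟨u, hu⟩ : ∃ u, 0 < (cqBlock p τ ρ u).trace.re := by
    by_contra! hcon
    have h1 := congrArg Complex.re (sum_trace_cqBlock hp hτ hρ)
    rw [Complex.re_sum, Complex.one_re] at h1
    linarith [Finset.sum_nonpos fun u (_ : u ∈ Finset.univ) => hcon u]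
  have ht : 0 < X.trace.re := hu.trans_le (htr u).2
  have hXp : X.PosSemidef := Matrix.nonneg_iff_posSemidef.1
    ((Matrix.nonneg_iff_posSemidef.2 (posSemidef_cqBlock hp.1 hτ hρ u)).trans (hX u))
  by_contra! hlt
  have h1 := (neg_logb_trace_le_condMinEntropy hp hτ hρ hXp ht hX).trans ((h p hp).trans
    (condMinEntropy_le_neg_logb hp hτ hσ hB hB1 (ht.trans hlt)))
  rw [neg_le_neg_iff] at h1
  exact (Real.logb_lt_logb one_lt_two ht hlt).not_ge h1

/-- If `ρ` is more informative than `σ`, then the statistics of each measurement on `R ⊗ Q'` are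
also those of a measurement on `R ⊗ Q`. -/
theorem MoreInformativeWith.exists_measurement [Nonempty U] [Nonempty Y] [DecidableEq Q]
    (h : MoreInformativeWith U τ ρ σ)
    (hτ : ∀ y, IsDensityMatrix (τ y)) (hρ : ∀ i, IsDensityMatrix (ρ i))
    (hσ : ∀ i, IsDensityMatrix (σ i)) {B : U → Matrix (R × Q') (R × Q') ℂ}
    (hB : ∀ u, (B u).PosSemidef) (hB1 : ∑ u, B u = 1) :
    ∃ M : U → Matrix (R × Q) (R × Q) ℂ, (∀ u, (M u).PosSemidef) ∧ ∑ u, M u = 1 ∧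
      ∀ u y x, (M u * (τ y ⊗ₖ ρ x)).trace = (B u * (τ y ⊗ₖ σ x)).trace := by
  have hreal (u : U) (k : Y × Fin 2) : (B u * (τ k.1 ⊗ₖ σ k.2)).trace =
      ((B u * (τ k.1 ⊗ₖ σ k.2)).trace.re : ℂ) := by
    have h1 := trace_mul_nonneg_of_posSemidef (hB u) ((hτ k.1).kronecker (hσ k.2)).1
    exact Complex.ext rfl (by simpa using (Complex.nonneg_iff.1 h1).2.symm)
  suffices hdual : ∀ (c : U → Y × Fin 2 → ℝ) (X : Matrix (R × Q) (R × Q) ℂ),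
      (∀ u, ∑ k, c u k • (τ k.1 ⊗ₖ ρ k.2) ≤ X) →
      ∑ u, ∑ k, c u k * (B u * (τ k.1 ⊗ₖ σ k.2)).trace.re ≤ X.trace.re by
    obtain ⟨M, hM, hM1, hMB⟩ := exists_measurement_of_forall_dual
      (fun k : Y × Fin 2 => τ k.1 ⊗ₖ ρ k.2) (fun k => ((hτ k.1).kronecker (hρ k.2)).1)
      (fun (u : U) k => (B u * (τ k.1 ⊗ₖ σ k.2)).trace.re) hdual
    exact ⟨M, hM, hM1, fun u y x => (hMB u (y, x)).trans (hreal u (y, x)).symm⟩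
  intro c X hX
  -- Payoffs which do not depend on the guess are worth the same in both games, so that a constant
  -- can be added to make `c` positive; it can then be scaled to a probability distribution.
  set s : ℝ := 1 + ∑ u, ∑ k, |c u k| with hs
  have hpos (u : U) (k : Y × Fin 2) : 0 < c u k + s := by
    have h1 : |c u k| ≤ ∑ u, ∑ k, |c u k| :=
      (Finset.single_le_sum (f := fun k => |c u k|) (fun k _ => abs_nonneg _)
        (Finset.mem_univ k)).trans (Finset.single_le_sum (f := fun u => ∑ k, |c u k|)
        (fun u _ => Finset.sum_nonneg fun k _ => abs_nonneg _) (Finset.mem_univ u))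
    linarith [neg_abs_le (c u k)]
  set w : ℝ := ∑ u, ∑ k, (c u k + s) with hw
  have hw0 : 0 < w := Finset.sum_pos
    (fun u _ => Finset.sum_pos (fun k _ => hpos u k) Finset.univ_nonempty) Finset.univ_nonempty
  set p : U × Y × Fin 2 → ℝ := fun i => w⁻¹ * (c i.1 i.2 + s) with hp
  have hps : p ∈ stdSimplex ℝ (U × Y × Fin 2) := by
    refine ⟨fun i => mul_nonneg (inv_nonneg.2 hw0.le) (hpos _ _).le, ?_⟩
    rw [hp, ← Finset.mul_sum, Fintype.sum_prod_type, ← hw, inv_mul_cancel₀ hw0.ne']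
  have h1 := h.sum_trace_mul_cqBlock_le hτ hρ hσ hB hB1 hps
    (X := w⁻¹ • (X + s • ∑ k : Y × Fin 2, (τ k.1 ⊗ₖ ρ k.2))) fun u => by
      rw [hp, cqBlock_affine]
      exact smul_le_smul_of_nonneg_left (add_le_add_left (hX u) _) (inv_nonneg.2 hw0.le)
  have hval : (∑ u, (B u * cqBlock p τ σ u).trace).re =
      w⁻¹ * (∑ u, ∑ k, c u k * (B u * (τ k.1 ⊗ₖ σ k.2)).trace.re +
        s * Fintype.card (Y × Fin 2)) := by
    have h2 : ∑ u, (B u * ∑ k : Y × Fin 2, (τ k.1 ⊗ₖ σ k.2)).trace =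
        Fintype.card (Y × Fin 2) := by
      rw [← Matrix.trace_sum, ← Finset.sum_mul, hB1, Matrix.one_mul, Matrix.trace_sum]
      simp [((hτ _).kronecker (hσ _)).2]
    simp only [hp, cqBlock_affine, Matrix.mul_smul, Matrix.mul_add, Matrix.trace_smul,
      Matrix.trace_add, ← Finset.smul_sum, Finset.sum_add_distrib, h2]
    simp only [Matrix.mul_sum, Matrix.trace_sum, Matrix.mul_smul, Matrix.trace_smul,
      Complex.real_smul, Complex.re_ofReal_mul, Complex.add_re, Complex.re_sum, Complex.natCast_re]
  rw [hval, Matrix.trace_smul, Complex.real_smul, Complex.re_ofReal_mul] at h1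
  have h3 := le_of_mul_le_mul_left h1 (inv_pos.2 hw0)
  rw [Matrix.trace_add, Matrix.trace_smul, Matrix.trace_sum] at h3
  simp only [((hτ _).kronecker (hρ _)).2, Complex.add_re, Complex.real_smul, Complex.re_ofReal_mul,
    Finset.sum_const, Finset.card_univ, nsmul_eq_mul, mul_one, Complex.natCast_re] at h3
  linarith

end

/-! ### Weyl operators and the Bell measurement -/

/-- The Weyl operators `W (a, b) = ∑ q, χ (b * (q + a)) |q + a⟩⟨q|`, products of shifts and
multiplications with characters, where `e` labels the source basis by `ZMod d`. -/
noncomputable def weylOperator {d : ℕ} [NeZero d] {Q : Type*} (e : Q ≃ ZMod d)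
    (u : ZMod d × ZMod d) : Matrix (ZMod d) Q ℂ :=
  Matrix.of fun r q => if r = e q + u.1 then ZMod.stdAddChar (u.2 * r) else 0

section

variable {d : ℕ} [NeZero d] {Q : Type*} (e : Q ≃ ZMod d)

theorem weylOperator_mul_conjTranspose [Fintype Q] (u : ZMod d × ZMod d) :
    weylOperator e u * (weylOperator e u).conjTranspose = 1 := by
  ext r r'
  rw [Matrix.mul_apply, Fintype.sum_eq_single (e.symm (r - u.1))]
  · by_cases h : r = r'
    · subst h
      simp [weylOperator, ← AddChar.map_neg_eq_conj, ← AddChar.map_add_eq_mul]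
    · simp [weylOperator, h, Ne.symm h]
  · intro q hq
    have : r ≠ e q + u.1 := fun h => hq (by simp [h])
    simp [weylOperator, this]

theorem conjTranspose_mul_weylOperator [Fintype Q] [DecidableEq Q] (u : ZMod d × ZMod d) :
    (weylOperator e u).conjTranspose * weylOperator e u = 1 :=
  (Matrix.mul_eq_one_comm_of_equiv e.symm).1 (weylOperator_mul_conjTranspose e u)

/-- The entries of the Weyl operators satisfy the completeness relation of an orthogonal operator
basis. -/
theorem sum_star_weylOperator_mul [DecidableEq Q] (r r' : ZMod d) (q q' : Q) :
    ∑ u, star (weylOperator e u r q) * weylOperator e u r' q' =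
      if r = r' ∧ q = q' then (d : ℂ) else 0 := by
  have h (a b : ZMod d) : star (weylOperator e (a, b) r q) * weylOperator e (a, b) r' q' =
      (if r = e q + a then if r' = e q' + a then ZMod.stdAddChar (b * (r' - r)) else 0 else 0) := by
    simp only [weylOperator, Matrix.of_apply]
    split_ifs
    · rw [Complex.star_def, ← AddChar.map_neg_eq_conj, ← AddChar.map_add_eq_mul]
      congr 1
      ring
    all_goals simp
  rw [Fintype.sum_prod_type, Fintype.sum_eq_single (r - e q)]
  · simp only [h, add_sub_cancel, if_true]
    by_cases h1 : r' = e q' + (r - e q)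
    · simp only [if_pos h1]
      rw [AddChar.sum_mulShift _ (ZMod.isPrimitive_stdAddChar d), ZMod.card]
      have h2 : r' - r = 0 ↔ (r = r' ∧ q = q') := by
        constructor
        · intro h3
          have h4 : r' = r := sub_eq_zero.1 h3
          refine ⟨h4.symm, e.injective ?_⟩
          have h5 : e q' - e q = 0 := by linear_combination h4 - h1
          exact (sub_eq_zero.1 h5).symm
        · rintro ⟨rfl, -⟩
          exact sub_self _
      simp [h2]
    · have h2 : ¬ (r = r' ∧ q = q') := by
        rintro ⟨rfl, rfl⟩
        exact h1 (by ring)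
      simp [h1, h2]
  · intro a ha
    have h1 : r ≠ e q + a := fun h1 => ha (by rw [h1]; ring)
    exact Finset.sum_eq_zero fun b _ => by rw [h, if_neg h1]

/-- The Bell measurement: the rank-one projections onto the vectorized complex conjugates of the
Weyl operators, each written as `Aᴴ * A / d` with a single row `A`. -/
noncomputable def bellMeasurement (u : ZMod d × ZMod d) :
    Matrix (ZMod d × Q) (ZMod d × Q) ℂ :=
  (d : ℝ)⁻¹ • ((Matrix.of fun (_ : Unit) i => weylOperator e u i.1 i.2).conjTranspose *
    Matrix.of fun (_ : Unit) i => weylOperator e u i.1 i.2)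

theorem posSemidef_bellMeasurement [Finite Q] (u : ZMod d × ZMod d) :
    (bellMeasurement e u).PosSemidef :=
  (Matrix.posSemidef_conjTranspose_mul_self _).smul (inv_nonneg.2 d.cast_nonneg)

theorem sum_bellMeasurement [DecidableEq Q] : ∑ u, bellMeasurement e u = 1 := by
  ext i j
  have h := sum_star_weylOperator_mul e i.1 j.1 i.2 j.2
  simp only [bellMeasurement, ← Finset.smul_sum, Matrix.smul_apply, Matrix.sum_apply,
    Matrix.mul_apply, Matrix.conjTranspose_apply, Matrix.of_apply, Finset.univ_unique,
    Finset.sum_singleton, h, Matrix.one_apply, Prod.ext_iff]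
  split_ifs
  · simp [NeZero.ne d]
  · simp

end

/-! ### Teleportation -/

/-- Pairing `Aᴴ * A` with `single a b 1 ⊗ X` gives the entries of the completely positive map which
has the rows of `A`, regarded as operators, as its Kraus operators. -/
theorem trace_mul_single_kronecker {S R Q : Type*} [Fintype S] [Fintype R] [DecidableEq R]
    [Fintype Q] (A : Matrix S (R × Q) ℂ) (X : Matrix Q Q ℂ) (a b : R) :
    (A.conjTranspose * A * (Matrix.single a b (1 : ℂ) ⊗ₖ X)).trace =
      (∑ s, (Matrix.of fun r q => A s (r, q)) * X *
        (Matrix.of fun r q => A s (r, q)).conjTranspose) a b := by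
  rw [Matrix.mul_assoc, Matrix.trace_mul_comm]
  simp only [Matrix.trace, Matrix.diag, Matrix.mul_apply, Matrix.sum_apply, Finset.sum_mul,
    Fintype.sum_prod_type, Matrix.kroneckerMap_apply, Matrix.conjTranspose_apply, Matrix.of_apply]
  refine Finset.sum_congr rfl fun s _ => ?_
  rw [Finset.sum_eq_single b]
  · refine Finset.sum_congr rfl fun q _ => ?_
    rw [Finset.sum_eq_single a]
    · simp
    · intro r _ hr
      simp [hr.symm]
    · simp
  · intro r _ hr
    simp [hr.symm]
  · simp

/-- Teleportation: a measurement `M` which has the same statistics on `X ⊗ ρ x` as the Bell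
measurement has on `X ⊗ σ x` yields a channel from `ρ` to `σ`. The channel measures `M` on the input
and one half of a maximally entangled state, and undoes the Weyl operator of the outcome on the
other half. -/
theorem exists_channel_of_measurement {d : ℕ} [NeZero d] {Q Q' : Type*} [Fintype Q] [DecidableEq Q]
    [Fintype Q'] [DecidableEq Q'] (e : Q' ≃ ZMod d) {ρ : Fin 2 → Matrix Q Q ℂ}
    {σ : Fin 2 → Matrix Q' Q' ℂ} {M : ZMod d × ZMod d → Matrix (ZMod d × Q) (ZMod d × Q) ℂ}
    (hM : ∀ u, (M u).PosSemidef) (hM1 : ∑ u, M u = 1)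
    (h : ∀ u (X : Matrix (ZMod d) (ZMod d) ℂ) x,
      (M u * (X ⊗ₖ ρ x)).trace = (bellMeasurement e u * (X ⊗ₖ σ x)).trace) :
    ∃ Φ : Matrix Q Q ℂ →CP Matrix Q' Q' ℂ, IsTracePreserving Φ ∧ ∀ i, Φ (ρ i) = σ i := by
  have hd : (d : ℂ) ≠ 0 := NeZero.ne _
  choose A hA using fun u => posSemidef_iff_exists_conjTranspose_mul_self.1 (hM u)
  set K : ZMod d × ZMod d → ZMod d × Q → Matrix (ZMod d) Q ℂ :=
    fun u s => Matrix.of fun r q => A u s (r, q)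
  set N : ZMod d × ZMod d → Matrix Q Q ℂ → Matrix (ZMod d) (ZMod d) ℂ :=
    fun u X => ∑ s, K u s * X * (K u s).conjTranspose with hN
  have hNM (u) (X : Matrix Q Q ℂ) (a b : ZMod d) :
      N u X a b = (M u * (Matrix.single a b (1 : ℂ) ⊗ₖ X)).trace := by
    rw [hA u, trace_mul_single_kronecker]
  have hNσ (u) (x : Fin 2) : N u (ρ x) =
      (d : ℂ)⁻¹ • (weylOperator e u * σ x * (weylOperator e u).conjTranspose) := by
    ext a b
    rw [hNM, h, bellMeasurement, Matrix.smul_mul, Matrix.trace_smul, trace_mul_single_kronecker]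
    simp only [Finset.univ_unique, Finset.sum_singleton, Matrix.of_apply]
    rw [Matrix.smul_apply, Complex.real_smul, smul_eq_mul]
    rw [Complex.ofReal_inv, Complex.ofReal_natCast]
    rfl
  have hc : ((√d : ℝ) : ℂ)⁻¹ * ((√d : ℝ) : ℂ)⁻¹ = (d : ℂ)⁻¹ := by
    rw [← mul_inv, ← Complex.ofReal_mul, Real.mul_self_sqrt d.cast_nonneg, Complex.ofReal_natCast]
  have hΦ (X : Matrix Q Q ℂ) : krausMap (fun i : (ZMod d × ZMod d) × (ZMod d × Q) =>
      ((√d : ℝ) : ℂ)⁻¹ • ((weylOperator e i.1).conjTranspose * K i.1 i.2)) X =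
      (d : ℂ)⁻¹ • ∑ u, (weylOperator e u).conjTranspose * N u X * weylOperator e u := by
    rw [krausMap_apply, Fintype.sum_prod_type, Finset.smul_sum]
    refine Finset.sum_congr rfl fun u _ => ?_
    simp only [hN, Matrix.mul_sum, Matrix.sum_mul, Finset.smul_sum]
    refine Finset.sum_congr rfl fun s _ => ?_
    rw [Matrix.conjTranspose_smul, Matrix.conjTranspose_mul, Matrix.conjTranspose_conjTranspose,
      Matrix.smul_mul, Matrix.smul_mul, Matrix.mul_smul, smul_smul, ← hc]
    simp only [Matrix.mul_assoc, star_inv₀, Complex.star_def, Complex.conj_ofReal]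
  refine ⟨krausMap fun i : (ZMod d × ZMod d) × (ZMod d × Q) =>
    ((√d : ℝ) : ℂ)⁻¹ • ((weylOperator e i.1).conjTranspose * K i.1 i.2),
    fun X => ?_, fun x => ?_⟩
  rotate_left
  · rw [hΦ]
    have h1 (u) : (weylOperator e u).conjTranspose * N u (ρ x) * weylOperator e u =
        (d : ℂ)⁻¹ • σ x := by
      rw [hNσ, Matrix.mul_smul, Matrix.smul_mul, ← Matrix.mul_assoc, ← Matrix.mul_assoc,
        conjTranspose_mul_weylOperator, Matrix.one_mul, Matrix.mul_assoc,
        conjTranspose_mul_weylOperator, Matrix.mul_one]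
    simp only [h1, Finset.sum_const, Finset.card_univ, Fintype.card_prod, ZMod.card]
    rw [← Nat.cast_smul_eq_nsmul ℂ, smul_smul, smul_smul]
    push_cast
    field_simp
    rw [one_smul]
  · rw [hΦ, Matrix.trace_smul, Matrix.trace_sum]
    have h1 (u) : ((weylOperator e u).conjTranspose * N u X * weylOperator e u).trace =
        (M u * ((1 : Matrix (ZMod d) (ZMod d) ℂ) ⊗ₖ X)).trace := by
      have h2 : (1 : Matrix (ZMod d) (ZMod d) ℂ) ⊗ₖ X =
          ∑ a, Matrix.single a a (1 : ℂ) ⊗ₖ X := by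
        rw [← Matrix.sum_single_one]
        ext i j
        simp [Matrix.sum_apply, Finset.sum_mul]
      rw [Matrix.mul_assoc, Matrix.trace_mul_comm, Matrix.mul_assoc, weylOperator_mul_conjTranspose,
        Matrix.mul_one, h2, Matrix.mul_sum, Matrix.trace_sum Finset.univ (fun a : ZMod d => _)]
      exact Finset.sum_congr rfl fun a _ => hNM u X a a
    simp only [h1]
    rw [← Matrix.trace_sum, ← Finset.sum_mul, hM1, Matrix.one_mul, Matrix.trace_kronecker,
      Matrix.trace_one, ZMod.card, smul_eq_mul, inv_mul_cancel_left₀ hd]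

/-! ### Existence of complete cq-channels -/

theorem span_isDensityMatrix (R : Type*) [Fintype R] :
    Submodule.span ℂ {A : Matrix R R ℂ | IsDensityMatrix A} = ⊤ := by
  classical
  rw [eq_top_iff, ← CStarAlgebra.span_nonneg, Submodule.span_le]
  intro A hA
  have hA' : A.PosSemidef := Matrix.nonneg_iff_posSemidef.1 hA
  obtain h | h := (Complex.nonneg_iff.1 hA'.trace_nonneg).1.eq_or_lt
  · have h0 : A = 0 := hA'.trace_eq_zero_iff.1
      (Complex.ext h.symm (Complex.nonneg_iff.1 hA'.trace_nonneg).2.symm)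
    rw [h0]
    exact Submodule.zero_mem _
  · obtain ⟨ω, hω, hAω⟩ := exists_isDensityMatrix_smul hA' h
    rw [hAω]
    exact Submodule.smul_of_tower_mem _ _ (Submodule.subset_span hω)

/-- The family consists of the members of a basis of density matrices, indexed by itself. -/
theorem exists_isCompleteCQChannel (R : Type) [Fintype R] :
    ∃ (Y : Type) (_ : Fintype Y) (τ : Y → Matrix R R ℂ), IsCompleteCQChannel τ := by
  classical
  obtain ⟨b, hb, hspan, hli⟩ :=
    exists_linearIndependent ℂ {A : Matrix R R ℂ | IsDensityMatrix A}
  rw [span_isDensityMatrix] at hspan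
  have hfin : Fintype b := hli.setFinite.fintype
  refine ⟨b, hfin, Subtype.val, ?_, fun y => hb y.2, by rwa [Subtype.range_coe]⟩
  have h1 := Module.finrank_eq_card_basis (Module.Basis.mk hli (by rw [Subtype.range_coe, hspan]))
  rw [Module.finrank_matrix, Module.finrank_self, mul_one] at h1
  rw [← h1, sq]

/-! ### The comparison theorem -/

/-- The restricted ordering suffices: for `R` and `U` of the sizes which occur in the teleportation
of `Q'`, it gives a measurement that imitates the Bell measurement, and hence a channel. -/
theorem RestrictedCompletelyMoreInformative.exists_channel {Q Q' : Type*} [Fintype Q]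
    [DecidableEq Q] [Fintype Q'] [DecidableEq Q']
    {ρ : Fin 2 → Matrix Q Q ℂ} {σ : Fin 2 → Matrix Q' Q' ℂ}
    (h : RestrictedCompletelyMoreInformative ρ σ)
    (hρ : ∀ i, IsDensityMatrix (ρ i)) (hσ : ∀ i, IsDensityMatrix (σ i)) :
    ∃ Φ : Matrix Q Q ℂ →CP Matrix Q' Q' ℂ, IsTracePreserving Φ ∧ ∀ i, Φ (ρ i) = σ i := by
  have : Nonempty Q' := (hσ 0).nonempty
  have : NeZero (Fintype.card Q') := ⟨Fintype.card_ne_zero⟩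
  set d := Fintype.card Q'
  let e : Q' ≃ ZMod d := Fintype.equivOfCardEq (by rw [ZMod.card])
  obtain ⟨Y, _, τ, hτ⟩ := exists_isCompleteCQChannel (ZMod d)
  have : Nonempty Y := by
    rw [← Fintype.card_pos_iff, hτ.1, ZMod.card]
    exact pow_pos (NeZero.pos d) 2
  have h1 : MoreInformativeWith (ZMod d × ZMod d) τ ρ σ :=
    h _ _ _ τ (ZMod.card d) (by rw [Fintype.card_prod, ZMod.card, sq]) hτ
  obtain ⟨M, hM, hM1, hMB⟩ := h1.exists_measurement hτ.2.1 hρ hσ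
    (posSemidef_bellMeasurement e) (sum_bellMeasurement e)
  refine exists_channel_of_measurement e hM hM1 fun u X x => ?_
  -- Both sides are linear in `X`, and agree on the states `τ y`, which span the operators.
  have hX : X ∈ Submodule.span ℂ (Set.range τ) := by rw [hτ.2.2]; trivial
  induction hX using Submodule.span_induction with
  | mem X hX =>
    obtain ⟨y, rfl⟩ := hX
    exact hMB u y x
  | zero => simp
  | add X Z _ _ hX hZ => simp only [Matrix.add_kronecker, Matrix.mul_add, Matrix.trace_add, hX, hZ]
  | smul c X _ hX => simp only [Matrix.smul_kronecker, Matrix.mul_smul, Matrix.trace_smul, hX]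

theorem lemma3 {Q Q' : Type*} [Fintype Q] [DecidableEq Q] [Fintype Q'] [DecidableEq Q']
    (ρ : Fin 2 → Matrix Q Q ℂ) (σ : Fin 2 → Matrix Q' Q' ℂ)
    (hρ : ∀ i, IsDensityMatrix (ρ i)) (hσ : ∀ i, IsDensityMatrix (σ i)) :
    (CompletelyMoreInformative ρ σ ↔
      ∃ Φ : Matrix Q Q ℂ →CP Matrix Q' Q' ℂ, IsTracePreserving Φ ∧ ∀ i, Φ (ρ i) = σ i) ∧
    (CompletelyMoreInformative ρ σ ↔ RestrictedCompletelyMoreInformative ρ σ) := by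
  have h1 : CompletelyMoreInformative ρ σ → RestrictedCompletelyMoreInformative ρ σ :=
    fun h U Y R _ _ _ _ τ _ _ hτ => h U Y R τ hτ
  have h2 : (∃ Φ : Matrix Q Q ℂ →CP Matrix Q' Q' ℂ,
      IsTracePreserving Φ ∧ ∀ i, Φ (ρ i) = σ i) → CompletelyMoreInformative ρ σ := by
    rintro ⟨Φ, hΦ, h⟩
    exact completelyMoreInformative_of_channel hρ hσ Φ hΦ h
  exact ⟨⟨fun h => (h1 h).exists_channel hρ hσ, h2⟩, h1, fun h => h2 (h.exists_channel hρ hσ)⟩
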